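/- All graphs are finite and simple. A \emph{cover} of a graph $G$ is a pair $\mathcal H=(L,H)$, where $H$ is a graph and $L\colon V(G)\to 2^{V(H)}$, such that: the sets $L(u)$, $u\in V(G)$, partition $V(H)$; each $L(u)$ induces a complete subgraph of $H$; if $H$ has an edge between $L(u)$ and $L(v)$, then $u=v$ or $uv\in E(G)$; and if $uv\in E(G)$, then the edges of $H$ between $L(u)$ and $L(v)$ form a (possibly empty, not necessarily perfect) matching. The cover is \emph{$k$-fold} if $|L(u)|=k$ for all $u\in V(G)$. For $\eta\in[0,1]$, an \emph{$(\eta,\mathcal H)$-coloring} of $G$ is a set $S\subseteq V(H)$ such that no edge of $H$ between distinct parts $L(u)$, $L(v)$ has both endpoints in $S$, and $|S\cap L(u)|\ge \eta|L(u)|$ for all $u\in V(G)$. For $k\in\mathbb N^+$ let \[ \theta_{DP}(G,k)=\max\{\eta\in[0,1] : G \text{ admits an } (\eta,\mathcal H)\text{-coloring for every } k\text{-fold cover } \mathcal H \text{ of } G\}, \] and let the \emph{fractional DP-chromatic number} of $G$ be $\chi^\ast_{DP}(G)=\inf\{\theta_{DP}(G,k)^{-1} : k\in\mathbb N^+\}$,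 where $0^{-1}=\infty$. \textbf{Corollary.} There is a function $\varepsilon\colon\mathbb N\to\mathbb R$ with $\varepsilon(d)\to 0$ as $d\to\infty$ such that for all $d,g\in\mathbb N^+$ there exists a graph $G_{d,g}$ with chromatic number at least $d$, girth at least $g$ (an acyclic graph having girth $\infty$), and, if $d\ge 2$, \[ \chi^\ast_{DP}(G_{d,g})\le (1+\varepsilon(d))\,\frac{d}{\ln d}. \] -/

import Mathlib

/-- A cover `(L, H)` of a graph `G`, the vertex set of the graph `H` being the type `W`. -/
structure DPCover {V : Type*} (G : SimpleGraph V) (W : Type*) where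
  /-- The graph `H`. -/
  H : SimpleGraph W
  /-- The function `L`, assigning to each vertex of `G` a set of vertices of `H`. -/
  L : V → Set W
  /-- The sets `L u` partition the vertex set of `H`. -/
  partition : ∀ x : W, ∃! u : V, x ∈ L u
  /-- Each `L u` induces a complete subgraph of `H`. -/
  complete : ∀ u : V, H.IsClique (L u)
  /-- Edges of `H` run only inside a part or between parts of adjacent vertices of `G`. -/
  eq_or_adj : ∀ u v : V, ∀ x ∈ L u, ∀ y ∈ L v, H.Adj x y → u = v ∨ G.Adj u v
  /-- For an edge `uv` of `G`, the edges of `H` between `L u` and `L v` form a matching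
  (as `G.Adj` is symmetric, the condition applies to both sides). -/
  matching : ∀ u v : V, G.Adj u v →
    ∀ x ∈ L u, ∀ y ∈ L v, ∀ y' ∈ L v, H.Adj x y → H.Adj x y' → y = y'

namespace DPCover

variable {V W : Type*} {G : SimpleGraph V}

/-- A cover is `k`-fold if `|L u| = k` for all vertices `u`. -/
def IsFold (C : DPCover G W) (k : ℕ) : Prop :=
  ∀ u : V, (C.L u).ncard = k

/-- `xy` is a cross-edge: an edge of `H` connecting distinct parts. -/
def IsCrossEdge (C : DPCover G W) (x y : W) : Prop :=
  C.H.Adj x y ∧ ∃ u v : V, u ≠ v ∧ x ∈ C.L u ∧ y ∈ C.L v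

/-- A set of vertices of `H` is quasi-independent if it spans no cross-edges. -/
def IsQuasiIndep (C : DPCover G W) (S : Set W) : Prop :=
  ∀ x ∈ S, ∀ y ∈ S, ¬ C.IsCrossEdge x y

/-- `S` is an `(η, (L, H))`-coloring of `G`. -/
def IsFracColoring (C : DPCover G W) (η : ℝ) (S : Set W) : Prop :=
  C.IsQuasiIndep S ∧ ∀ u : V, η * ((C.L u).ncard : ℝ) ≤ ((S ∩ C.L u).ncard : ℝ)

end DPCover

/-- `θ_DP(G, k)`: the largest `η ∈ [0, 1]` such that `G` admits an `(η, 𝓗)`-coloring for every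
`k`-fold cover `𝓗` of `G`. The set contains `0`. -/
noncomputable def thetaDP {V : Type*} (G : SimpleGraph V) (k : ℕ) : ℝ :=
  sSup {η : ℝ | η ∈ Set.Icc (0 : ℝ) 1 ∧
    ∀ (W : Type) [Finite W] (C : DPCover G W), C.IsFold k → ∃ S : Set W, C.IsFracColoring η S}

/-- The fractional DP-chromatic number `inf {θ_DP(G, k)⁻¹ : k ≥ 1}`. It is computed in `[0, ∞]`,
since `θ_DP(G, k)` may vanish for some `k`, in which case its inverse is `∞`. -/
noncomputable def fracDPChromaticNumber {V : Type*} (G : SimpleGraph V) : ENNReal :=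
  ⨅ k : ℕ+, (ENNReal.ofReal (thetaDP G k))⁻¹

/-! The upper bound comes from a greedy random selection along an acyclic orientation of out-degree
at most D in which distinct out-neighbours of a vertex reach disjoint sets (`TreeOrientation`). The
matchings lift it to any cover; there an element is selected if it is activated and none of its
successors is selected. The fates of the successors are independent, so activation with probability
p / (1 - p) ^ (out-degree) makes every selection probability exactly p; this is legitimate once p ≤
(1 - p) ^ D (`bernoulliExpect_greedySelected`). Selections within one list are pairwise independent,
so for k large compared with |V| a second-moment bound leaves at least (1 - δ)pk selected elements
in every list (`exists_independent_set_large_inter`). One may take p ~ ln D / D.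

Such orientations exist with large chromatic number and girth by Descartes' construction: matching
copies of G to the edges of a Ramsey hypergraph raises by one both the number of colours that do not
suffice and the out-degree bound. The sparse hypergraphs come from partite amalgamation
(`HasPartiteRamseyHypergraph.insert`). In both constructions `IsForestOn.of_pieces` controls short
cycles. -/

/-! ### Short cycles and contraction -/

namespace SimpleGraph

/-- Every nonempty set of fewer than `g` vertices of `s` has a vertex with at most one
neighbour in that set; equivalently, `G` has no cycle of length less than `g` inside `s`. -/
def IsForestOn {V : Type*} (G : SimpleGraph V) (s : Set V) (g : ℕ) : Prop :=
  ∀ U : Finset V, (U : Set V) ⊆ s → U.Nonempty → U.card < g →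
    ∃ v ∈ U, ∀ a ∈ U, ∀ b ∈ U, G.Adj v a → G.Adj v b → a = b

/-- A forest on at least two vertices has two ends. If the end found is `w` itself, delete it and
avoid its only neighbour in the rest: any other end stays an end when `w` is put back. -/
theorem IsForestOn.exists_end_ne {V : Type*} {G : SimpleGraph V} {s : Set V} {g : ℕ}
    (h : G.IsForestOn s g) (U : Finset V) (hU : (U : Set V) ⊆ s) (h1 : 1 < U.card)
    (hg : U.card < g) (w : V) :
    ∃ v ∈ U, v ≠ w ∧ ∀ a ∈ U, ∀ b ∈ U, G.Adj v a → G.Adj v b → a = b := by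
  classical
  induction hn : U.card using Nat.strong_induction_on generalizing U w with
  | _ n ih =>
  obtain ⟨v, hv, hend⟩ := h U hU (Finset.card_pos.mp (by omega)) hg
  by_cases hvw : v = w
  swap
  · exact ⟨v, hv, hvw, hend⟩
  subst hvw
  have hcard := Finset.card_erase_of_mem hv
  have hsub : ((U.erase v : Finset V) : Set V) ⊆ s :=
    fun x hx => hU (Finset.erase_subset _ _ hx)
  -- Deleting `v` leaves a single vertex here, too few for the induction hypothesis.
  by_cases h2 : U.card = 2
  · obtain ⟨x, hx⟩ := Finset.card_eq_one.mp (show (U.erase v).card = 1 by omega)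
    have hxU : x ∈ U.erase v := by simp [hx]
    have key : ∀ a ∈ U, G.Adj x a → a = v := by
      intro a ha hxa
      by_contra hav
      have : a ∈ U.erase v := Finset.mem_erase.mpr ⟨hav, ha⟩
      rw [hx, Finset.mem_singleton] at this
      exact hxa.ne this.symm
    exact ⟨x, Finset.mem_of_mem_erase hxU, Finset.ne_of_mem_erase hxU,
      fun a ha b hb h1 h2 => (key a ha h1).trans (key b hb h2).symm⟩
  · have : ∃ w', ∀ a ∈ U, G.Adj v a → a = w' := by
      by_cases hex : ∃ a ∈ U, G.Adj v a
      · obtain ⟨a, ha, hva⟩ := hex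
        exact ⟨a, fun b hb hvb => hend b hb a ha hvb hva⟩
      · push Not at hex
        exact ⟨v, fun a ha hva => (hex a ha hva).elim⟩
    obtain ⟨w', hw'⟩ := this
    obtain ⟨x, hx, hxw, hxend⟩ := ih _ (by omega) (U.erase v) hsub (by omega) (by omega) w' rfl
    have hxU := Finset.mem_of_mem_erase hx
    have hnv : ¬ G.Adj x v := fun hadj => hxw (hw' x hxU hadj.symm)
    refine ⟨x, hxU, Finset.ne_of_mem_erase hx, fun a ha b hb hxa hxb => ?_⟩
    refine hxend a ?_ b ?_ hxa hxb
    · exact Finset.mem_erase.mpr ⟨fun e => hnv (e ▸ hxa), ha⟩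
    · exact Finset.mem_erase.mpr ⟨fun e => hnv (e ▸ hxb), hb⟩

/-- Choosing preimages transports a finite set to `G` without losing adjacencies, so `f` need be
neither injective nor a homomorphism. -/
theorem IsForestOn.of_reflects {V V' : Type*} {G : SimpleGraph V} {G' : SimpleGraph V'}
    {g : ℕ} (h : G.IsForestOn Set.univ g) {s : Set V'} (f : V → V') (hs : s ⊆ Set.range f)
    (hf : ∀ a b, G'.Adj (f a) (f b) → G.Adj a b) : G'.IsForestOn s g := by
  classical
  intro U hU hne hg
  have : Nonempty V := by
    obtain ⟨x, hx⟩ := hne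
    obtain ⟨y, -⟩ := hs (hU hx)
    exact ⟨y⟩
  choose! k hk using fun x (hx : x ∈ U) => hs (hU hx)
  obtain ⟨v, hv, hend⟩ := h (U.image k) (Set.subset_univ _) (hne.image k)
    (Finset.card_image_le.trans_lt hg)
  obtain ⟨u, hu, rfl⟩ := Finset.mem_image.mp hv
  refine ⟨u, hu, fun a ha b hb hua hub => ?_⟩
  have := hend (k a) (Finset.mem_image_of_mem _ ha) (k b) (Finset.mem_image_of_mem _ hb)
    (hf _ _ (by rwa [hk u hu, hk a ha])) (hf _ _ (by rwa [hk u hu, hk b hb]))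
  rw [← hk a ha, ← hk b hb, this]

theorem IsForestOn.le_egirth {V : Type*} {G : SimpleGraph V} {g : ℕ}
    (h : G.IsForestOn Set.univ g) : (g : ℕ∞) ≤ G.egirth := by
  classical
  rw [SimpleGraph.le_egirth]
  intro a w hw
  by_contra hlt
  have hlt : w.length < g := by
    simpa using hlt
  have hsupp : w.support.toFinset = w.support.tail.toFinset := by
    rw [← w.cons_tail_support, List.toFinset_cons, List.tail_cons, Finset.insert_eq_self]
    exact List.mem_toFinset.mpr (Walk.end_mem_tail_support hw.not_nil)
  have hcard : w.support.toFinset.card ≤ w.length := by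
    rw [hsupp]
    refine (List.toFinset_card_le _).trans ?_
    simp
  obtain ⟨v, hv, hend⟩ := h w.support.toFinset (Set.subset_univ _) ⟨a, by simp⟩ (by omega)
  have hv' : v ∈ w.support := by simpa using hv
  have hc := hw.rotate hv'
  have hmem : ∀ x ∈ (w.rotate v hv').support, x ∈ w.support.toFinset := by
    intro x hx
    simpa [Walk.mem_support_rotate_iff] using hx
  -- Rotated to start at `v`, the cycle shows two distinct neighbours of `v`: its second and its
  -- penultimate vertex.
  refine hc.snd_ne_penultimate (hend _ (hmem _ ?_) _ (hmem _ ?_) ?_ ?_)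
  · exact Walk.getVert_mem_support _ _
  · exact Walk.getVert_mem_support _ _
  · exact Walk.adj_snd hc.not_nil
  · exact (Walk.adj_penultimate hc.not_nil).symm

/-- A graph that maps onto a bipartite graph `Y` by contracting the pieces lying over one side of
`Y`, and injectively over the other side `B`, has no short cycles if neither the pieces nor `Y`
have; the bound for `Y` improves by one. -/
theorem IsForestOn.of_pieces {Z M : Type*} {G : SimpleGraph Z} {Y : SimpleGraph M} {g : ℕ}
    (β : Z → M) (B : Set M)
    (hadj : ∀ z z', G.Adj z z' → β z = β z' ∨ Y.Adj (β z) (β z'))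
    (hinj : ∀ z z', β z ∈ B → β z = β z' → z = z')
    (hbip : ∀ m m', Y.Adj m m' → (m ∈ B ↔ m' ∉ B))
    (hone : ∀ z x x', β z ∉ B → β x ∈ B → β x' ∈ B → G.Adj z x → G.Adj z x' → x = x')
    (hY : Y.IsForestOn Set.univ g)
    (hpiece : ∀ m, m ∉ B → G.IsForestOn {z | β z = m ∨ Y.Adj m (β z)} (g + 1)) :
    G.IsForestOn Set.univ (g + 1) := by
  classical
  intro U _ hne hg
  by_contra hcon
  push Not at hcon
  have hside : ∀ z z', G.Adj z z' → β z ∈ B → β z' ∉ B ∧ Y.Adj (β z) (β z') := by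
    intro z z' hzz hz
    rcases hadj z z' hzz with he | he
    · exact (hzz.ne (hinj z z' hz he)).elim
    · exact ⟨(hbip _ _ he).mp hz, he⟩
  -- Heavy points are those through which `U` passes from one piece to another.
  let heavy : Z → Prop := fun x => β x ∈ B ∧ x ∈ U ∧
    ∃ z ∈ U, ∃ z' ∈ U, G.Adj x z ∧ G.Adj x z' ∧ β z ≠ β z'
  -- If a piece met by `U` had at most one heavy point `x0` attached, its part of `U` together with
  -- the attached points would have an end other than `x0`. All neighbours of that end in `U` lie in
  -- this part, so it would be an end of `U`.
  have htwo : ∀ j ∉ B, (∃ z ∈ U, β z = j) → ∃ x x', x ≠ x' ∧ heavy x ∧ heavy x' ∧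
      (∃ z ∈ U, β z = j ∧ G.Adj x z) ∧ (∃ z ∈ U, β z = j ∧ G.Adj x' z) := by
    intro j hj hjU
    by_contra hno
    push Not at hno
    have hx0 : ∃ x0, ∀ x, heavy x → (∃ z ∈ U, β z = j ∧ G.Adj x z) → x = x0 := by
      by_cases hex : ∃ x, heavy x ∧ ∃ z ∈ U, β z = j ∧ G.Adj x z
      · obtain ⟨x0, hx0, hl0⟩ := hex
        refine ⟨x0, fun x hx hl => ?_⟩
        by_contra hxx
        obtain ⟨z, hz, hzj, hadj⟩ := hl0
        exact hno x x0 hxx hx hx0 hl z hz hzj hadj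
      · obtain ⟨z, -, -⟩ := hjU
        exact ⟨z, fun x hx hl => (hex ⟨x, hx, hl⟩).elim⟩
    obtain ⟨x0, hx0⟩ := hx0
    let Uj := U.filter fun z => β z = j ∨ (β z ∈ B ∧ ∃ z' ∈ U, β z' = j ∧ G.Adj z z')
    have hUjs : (Uj : Set Z) ⊆ {z | β z = j ∨ Y.Adj j (β z)} := by
      intro z hz
      rcases (Finset.mem_filter.mp hz).2 with he | ⟨hB, z', hz', hzj, hzz⟩
      · exact Or.inl he
      · right
        have := (hside z z' hzz hB).2.symm
        rwa [hzj] at this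
    have hnbr : ∀ z ∈ U, β z = j → ∀ a ∈ U, G.Adj z a → a ∈ Uj := by
      intro z hz hzj a ha hza
      refine Finset.mem_filter.mpr ⟨ha, ?_⟩
      rcases hadj z a hza with he | he
      · exact Or.inl (he ▸ hzj)
      · right
        refine ⟨?_, z, hz, hzj, hza.symm⟩
        have := hbip _ _ he
        rw [hzj] at this
        tauto
    have hcard : 1 < Uj.card := by
      obtain ⟨z, hz, hzj⟩ := hjU
      obtain ⟨a, ha, b, hb, hza, hzb, hab⟩ := hcon z hz
      exact Finset.one_lt_card.mpr
        ⟨a, hnbr z hz hzj a ha hza, b, hnbr z hz hzj b hb hzb, hab⟩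
    obtain ⟨v, hv, hvx, hend⟩ := (hpiece j hj).exists_end_ne Uj hUjs hcard
      ((Finset.card_le_card (Finset.filter_subset _ _)).trans_lt hg) x0
    obtain ⟨hvU, hv'⟩ := Finset.mem_filter.mp hv
    obtain ⟨a, ha, b, hb, hva, hvb, hab⟩ := hcon v hvU
    rcases hv' with hvj | ⟨hvB, z', hz', hzj, hvz⟩
    · exact hab (hend a (hnbr v hvU hvj a ha hva) b (hnbr v hvU hvj b hb hvb) hva hvb)
    · have hall : ∀ c ∈ U, G.Adj v c → c ∈ Uj := by
        intro c hc hvc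
        refine Finset.mem_filter.mpr ⟨hc, Or.inl ?_⟩
        by_contra hcj
        exact hvx (hx0 v ⟨hvB, hvU, z', hz', c, hc, hvz, hvc, by rw [hzj]; exact Ne.symm hcj⟩
          ⟨z', hz', hzj, hvz⟩)
      exact hab (hend a (hall a ha hva) b (hall b hb hvb) hva hvb)
  have hex : ∃ z ∈ U, β z ∉ B := by
    obtain ⟨v, hv⟩ := hne
    by_cases hvB : β v ∈ B
    · obtain ⟨a, ha, -, -, hva, -, -⟩ := hcon v hv
      exact ⟨a, ha, (hside v a hva hvB).1⟩
    · exact ⟨v, hv, hvB⟩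
  let U' := (U.image β).filter fun m => m ∉ B ∨ ∃ x, heavy x ∧ β x = m
  have hmem : ∀ z ∈ U, β z ∉ B → β z ∈ U' := fun z hz hB =>
    Finset.mem_filter.mpr ⟨Finset.mem_image_of_mem _ hz, Or.inl hB⟩
  have hmemh : ∀ x, heavy x → β x ∈ U' := fun x hx =>
    Finset.mem_filter.mpr ⟨Finset.mem_image_of_mem _ hx.2.1, Or.inr ⟨x, hx, rfl⟩⟩
  -- Two heavy points attached to one piece meet it in different vertices by `hone`, so `β`
  -- identifies two vertices of `U`; this gains the one.
  have hlt : U'.card < g := by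
    obtain ⟨z0, hz0, hz0B⟩ := hex
    obtain ⟨x, x', hxx, hx, hx', ⟨z, hz, hzj, hxz⟩, ⟨z', hz', hzj', hxz'⟩⟩ :=
      htwo _ hz0B ⟨z0, hz0, rfl⟩
    have hzz : z ≠ z' := by
      rintro rfl
      exact hxx (hone z x x' (hzj ▸ hz0B) hx.1 hx'.1 hxz.symm hxz'.symm)
    have h1 : (U.image β).card < U.card := by
      refine lt_of_le_of_ne Finset.card_image_le fun he => ?_
      exact hzz (Finset.card_image_iff.mp he hz hz' (hzj.trans hzj'.symm))
    have h2 : U'.card ≤ (U.image β).card := Finset.card_le_card (Finset.filter_subset _ _)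
    omega
  -- In `U'` every piece sees two heavy points and every heavy point sees two pieces, so it has no
  -- end.
  obtain ⟨m, hm, hend⟩ := hY U' (Set.subset_univ _)
    (by obtain ⟨z, hz, hzB⟩ := hex; exact ⟨_, hmem z hz hzB⟩) hlt
  obtain ⟨hmU, hm'⟩ := Finset.mem_filter.mp hm
  rcases hm' with hmB | ⟨x, hx, rfl⟩
  · obtain ⟨z0, hz0, rfl⟩ := Finset.mem_image.mp hmU
    obtain ⟨x, x', hxx, hx, hx', ⟨z, hz, hzj, hxz⟩, ⟨z', hz', hzj', hxz'⟩⟩ :=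
      htwo _ hmB ⟨z0, hz0, rfl⟩
    have h1 := (hside x z hxz hx.1).2.symm
    have h2 := (hside x' z' hxz' hx'.1).2.symm
    rw [hzj] at h1
    rw [hzj'] at h2
    exact hxx (hinj x x' hx.1 (hend _ (hmemh x hx) _ (hmemh x' hx') h1 h2))
  · obtain ⟨hxB, hxU, z, hz, z', hz', hxz, hxz', hne⟩ := hx
    have h1 := hside x z hxz hxB
    have h2 := hside x z' hxz' hxB
    exact hne (hend _ (hmem z hz h1.1) _ (hmem z' hz' h2.1) h1.2 h2.2)

end SimpleGraph

/-! ### Sparse Ramsey hypergraphs by partite amalgamation -/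

/-- The incidence graph between the points `X` and the edges `J` of a hypergraph whose edges are
parametrised by `e`. -/
def incidenceGraph {X J R : Type*} (e : J → R → X) : SimpleGraph (X ⊕ J) where
  Adj
    | .inl x, .inr j => ∃ r, e j r = x
    | .inr j, .inl x => ∃ r, e j r = x
    | _, _ => False
  symm := ⟨by rintro (x | j) (y | k) h <;> exact h⟩
  loopless := ⟨by rintro (x | j) h <;> exact h⟩

theorem incidenceGraph_adj_left {X J R : Type*} {e : J → R → X} {x : X} {m : X ⊕ J} :
    (incidenceGraph e).Adj (.inl x) m ↔ ∃ j r, m = .inr j ∧ e j r = x := by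
  rcases m with y | j <;> simp [incidenceGraph]

theorem incidenceGraph_adj_right {X J R : Type*} {e : J → R → X} {j : J} {m : X ⊕ J} :
    (incidenceGraph e).Adj (.inr j) m ↔ ∃ r, m = .inl (e j r) := by
  rcases m with y | k <;> simp [incidenceGraph, eq_comm]

theorem incidenceGraph_bipartite {X J R : Type*} {e : J → R → X} (m m' : X ⊕ J)
    (h : (incidenceGraph e).Adj m m') :
    m ∈ Set.range (Sum.inl : X → X ⊕ J) ↔ m' ∉ Set.range (Sum.inl : X → X ⊕ J) := by
  rcases m with x | j <;> rcases m' with y | k <;> simp_all [incidenceGraph]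

theorem exists_embedding_monochromatic {C R : Type*} [Finite C] [Nonempty C] [Finite R]
    (f : C × R → C) : ∃ j : R ↪ C × R, ∀ r r', f (j r) = f (j r') := by
  classical
  have := Fintype.ofFinite C
  have := Fintype.ofFinite R
  obtain ⟨c, hc⟩ := Fintype.exists_le_card_fiber_of_mul_le_card (f := f) (n := Fintype.card R)
    (by rw [Fintype.card_prod])
  rw [← Fintype.card_subtype] at hc
  obtain ⟨k⟩ := Function.Embedding.nonempty_of_card_le hc
  exact ⟨k.trans (Function.Embedding.subtype _), fun r t => (k r).2.trans (k t).2.symm⟩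

/-- Hypergraphs of every uniformity whose incidence graphs have no cycles of length less than
`g` and that have a monochromatic edge in every colouring. -/
def HasSparseRamseyHypergraphs (g : ℕ) : Prop :=
  ∀ (R C : Type) [Finite R] [Finite C] [Nonempty C],
    ∃ (X J : Type) (_ : Finite X) (_ : Finite J) (e : J → R → X),
      (∀ j, Function.Injective (e j)) ∧ (incidenceGraph e).IsForestOn Set.univ g ∧
      ∀ f : X → C, ∃ j, ∀ r t, f (e j r) = f (e j t)

/-- A hypergraph with points partitioned by `π` into parts indexed by `A`, each edge meeting every
part at most once, that has a monochromatic edge in every colouring that is constant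
on the parts outside `I`. -/
def HasPartiteRamseyHypergraph (g : ℕ) (R C A : Type) (I : Finset A) : Prop :=
  ∃ (X J : Type) (_ : Finite X) (_ : Finite J) (e : J → R → X) (π : X → A),
    (∀ j, Function.Injective (π ∘ e j)) ∧ (incidenceGraph e).IsForestOn Set.univ g ∧
    ∀ f : X → C, (∀ x x', π x ∉ I → π x = π x' → f x = f x') →
      ∃ j, ∀ r r', f (e j r) = f (e j r')

/-- Take pairwise disjoint edges, one for each embedding of `R` in the index set: the incidence
graph is a union of stars. A colouring constant on parts is a colouring of `C × R`, to which the
pigeonhole principle applies. -/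
theorem hasPartiteRamseyHypergraph_empty (g : ℕ) (R C : Type) [Finite R] [Finite C]
    [Nonempty C] : HasPartiteRamseyHypergraph g R C (C × R) ∅ := by
  classical
  refine ⟨(R ↪ C × R) × R, R ↪ C × R, inferInstance, inferInstance, fun j r => (j, r),
    fun x => x.1 x.2, fun j => j.injective, ?_, ?_⟩
  · intro U _ hne _
    by_cases h : ∃ x, Sum.inl x ∈ U
    · obtain ⟨x, hx⟩ := h
      refine ⟨_, hx, fun a _ b _ ha hb => ?_⟩
      obtain ⟨j, r, rfl, rfl⟩ := incidenceGraph_adj_left.mp ha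
      obtain ⟨j', r', rfl, h'⟩ := incidenceGraph_adj_left.mp hb
      exact congrArg Sum.inr (Prod.ext_iff.mp h').1.symm
    · obtain ⟨x | j, hm⟩ := hne
      · exact (h ⟨x, hm⟩).elim
      · refine ⟨_, hm, fun a haU b _ ha _ => ?_⟩
        obtain ⟨r, rfl⟩ := incidenceGraph_adj_right.mp ha
        exact (h ⟨_, haU⟩).elim
  · intro f hf
    have : ∃ col : C × R → C, ∀ x : (R ↪ C × R) × R, f x = col (x.1 x.2) := by
      refine ⟨fun i => if h : ∃ x : (R ↪ C × R) × R, x.1 x.2 = i then f h.choose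
        else Classical.arbitrary C, fun x => ?_⟩
      have h : ∃ y : (R ↪ C × R) × R, y.1 y.2 = x.1 x.2 := ⟨x, rfl⟩
      simp only [dif_pos h]
      exact hf _ _ (by simp) h.choose_spec.symm
    obtain ⟨col, hcol⟩ := this
    obtain ⟨j, hj⟩ := exists_embedding_monochromatic col
    exact ⟨j, fun r r' => by rw [hcol, hcol]; exact hj r r'⟩

/-- Amalgamation: for every edge of a sparse hypergraph on `P`, glue in a copy of the given system
whose part `i` is that edge. A monochromatic edge upstairs makes part `i` of some copy constant in
colour, and the old property applies to this copy. -/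
theorem HasPartiteRamseyHypergraph.insert {g : ℕ} (hg : HasSparseRamseyHypergraphs g)
    {R C A : Type} [Finite C] [Nonempty C] [DecidableEq A] {I : Finset A} (i : A)
    (h : HasPartiteRamseyHypergraph (g + 1) R C A I) :
    HasPartiteRamseyHypergraph (g + 1) R C A (insert i I) := by
  obtain ⟨X, J, _, _, e, π, hinj, hforest, hmono⟩ := h
  obtain ⟨P, K, _, _, E, hE, hEforest, hEmono⟩ := hg {x : X // π x = i} C
  let q : K → X → P ⊕ (K × {x : X // π x ≠ i}) := fun y x =>
    if h : π x = i then .inl (E y ⟨x, h⟩) else .inr (y, ⟨x, h⟩)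
  have hq1 : ∀ y x (h : π x = i), q y x = .inl (E y ⟨x, h⟩) := fun y x h => dif_pos h
  have hq2 : ∀ y x (h : π x ≠ i), q y x = .inr (y, ⟨x, h⟩) := fun y x h => dif_neg h
  have hqinj : ∀ y, Function.Injective (q y) := by
    intro y x x' hxx
    by_cases h : π x = i <;> by_cases h' : π x' = i
    · rw [hq1 y x h, hq1 y x' h'] at hxx
      exact Subtype.ext_iff.mp (hE y (Sum.inl_injective hxx))
    · rw [hq1 y x h, hq2 y x' h'] at hxx
      cases hxx
    · rw [hq2 y x h, hq1 y x' h'] at hxx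
      cases hxx
    · rw [hq2 y x h, hq2 y x' h'] at hxx
      exact Subtype.ext_iff.mp (Prod.ext_iff.mp (Sum.inr_injective hxx)).2
  let π' : P ⊕ (K × {x : X // π x ≠ i}) → A := Sum.elim (fun _ => i) (fun z => π z.2.1)
  have hπ' : ∀ y x, π' (q y x) = π x := by
    intro y x
    by_cases h : π x = i
    · rw [hq1 y x h, h]; rfl
    · rw [hq2 y x h]; rfl
  let e' : K × J → R → P ⊕ (K × {x : X // π x ≠ i}) := fun yj r => q yj.1 (e yj.2 r)
  refine ⟨P ⊕ (K × {x : X // π x ≠ i}), K × J, inferInstance, inferInstance, e', π', ?_, ?_, ?_⟩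
  · intro yj r r' hr
    refine hinj yj.2 ?_
    simpa only [Function.comp, e', hπ'] using hr
  -- Copy `y`, apart from its part `i`, is contracted to the edge `y` of `E`.
  · let β : (P ⊕ (K × {x : X // π x ≠ i})) ⊕ (K × J) → P ⊕ K :=
      Sum.elim (Sum.map id Prod.fst) (fun z => .inr z.1)
    have hβ : ∀ y j r, β (.inl (q y (e j r))) = .inr y ∨
        (incidenceGraph E).Adj (β (.inl (q y (e j r)))) (.inr y) := by
      intro y j r
      by_cases h : π (e j r) = i
      · rw [hq1 y _ h]
        exact Or.inr (incidenceGraph_adj_left.mpr ⟨y, ⟨_, h⟩, rfl, rfl⟩)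
      · rw [hq2 y _ h]
        exact Or.inl rfl
    refine SimpleGraph.IsForestOn.of_pieces (Y := incidenceGraph E) β (Set.range Sum.inl)
      ?_ ?_ incidenceGraph_bipartite ?_ hEforest ?_
    · rintro (z | ⟨y, j⟩) z' hzz
      · obtain ⟨⟨y, j⟩, r, rfl, rfl⟩ := incidenceGraph_adj_left.mp hzz
        exact hβ y j r
      · obtain ⟨r, rfl⟩ := incidenceGraph_adj_right.mp hzz
        exact (hβ y j r).imp Eq.symm SimpleGraph.Adj.symm
    · rintro ((x | z) | z) ((x' | z') | z') hz hzz <;> simp_all [β]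
    · rintro (z | ⟨y, j⟩) x x' hz hx hx' hzx hzx'
      · obtain ⟨⟨y, j⟩, r, rfl, -⟩ := incidenceGraph_adj_left.mp hzx
        simp [β] at hx
      · obtain ⟨r, rfl⟩ := incidenceGraph_adj_right.mp hzx
        obtain ⟨r', rfl⟩ := incidenceGraph_adj_right.mp hzx'
        have key : ∀ r, β (.inl (e' (y, j) r)) ∈ Set.range Sum.inl → π (e j r) = i := by
          intro r hr
          by_contra h
          simp only [e', hq2 y _ h] at hr
          simp [β] at hr
        -- Being partite matters here: an edge meets part `i` at most once, so it touches its copy's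
        -- boundary in at most one point.
        rw [hinj j ((key r hx).trans (key r' hx').symm)]
    · rintro (x | y) hm
      · exact (hm ⟨x, rfl⟩).elim
      · refine hforest.of_reflects (Sum.map (q y) (fun j => (y, j))) ?_ ?_
        · rintro ((x | ⟨y', x⟩) | ⟨y', j⟩) hz
          · rcases hz with hz | hz
            · simp [β] at hz
            · obtain ⟨r, hr⟩ := incidenceGraph_adj_right.mp hz
              refine ⟨.inl r.1, ?_⟩
              simp only [β, Sum.elim_inl, Sum.map_inl, id, Sum.inl.injEq] at hr
              rw [Sum.map_inl, hq1 y _ r.2, hr]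
          · rcases hz with hz | hz
            · obtain rfl : y' = y := by simpa [β] using hz
              exact ⟨.inl x.1, by rw [Sum.map_inl, hq2 y' _ x.2]⟩
            · obtain ⟨r, hr⟩ := incidenceGraph_adj_right.mp hz
              simp [β] at hr
          · rcases hz with hz | hz
            · obtain rfl : y' = y := by simpa [β] using hz
              exact ⟨.inr j, rfl⟩
            · obtain ⟨r, hr⟩ := incidenceGraph_adj_right.mp hz
              simp [β] at hr
        · rintro (x | j) (x' | j') hadj
          · exact hadj
          · obtain ⟨r, hr⟩ := hadj
            exact ⟨r, hqinj y hr⟩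
          · obtain ⟨r, hr⟩ := hadj
            exact ⟨r, hqinj y hr⟩
          · exact hadj
  · intro f hf
    obtain ⟨y, hy⟩ := hEmono (fun x => f (.inl x))
    obtain ⟨j, hj⟩ := hmono (fun x => f (q y x)) (by
      intro x x' hx hxx
      by_cases h : π x = i
      · rw [hq1 y x h, hq1 y x' (hxx ▸ h)]
        exact hy _ _
      · exact hf _ _ (by rw [hπ']; simp [h, hx]) (by rw [hπ', hπ', hxx]))
    exact ⟨(y, j), hj⟩

/-- At zero sparsity is vacuous. Afterwards the parts are freed one at a time, each amalgamation
using hypergraphs of the previous sparsity. -/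
theorem hasSparseRamseyHypergraphs (g : ℕ) : HasSparseRamseyHypergraphs g := by
  induction g with
  | zero =>
    intro R C _ _ _
    exact ⟨C × R, R ↪ C × R, inferInstance, inferInstance, fun j => j, fun j => j.injective,
      fun U _ _ h => absurd h (Nat.not_lt_zero _), exists_embedding_monochromatic⟩
  | succ g ih =>
    intro R C _ _ _
    classical
    have := Fintype.ofFinite (C × R)
    have key : ∀ I : Finset (C × R), HasPartiteRamseyHypergraph (g + 1) R C (C × R) I := by
      intro I
      induction I using Finset.induction_on with
      | empty => exact hasPartiteRamseyHypergraph_empty (g + 1) R C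
      | insert i I _ hI => exact hI.insert ih i
    obtain ⟨X, J, hX, hJ, e, π, hinj, hforest, hmono⟩ := key Finset.univ
    exact ⟨X, J, hX, hJ, e, fun j => (hinj j).of_comp, hforest,
      fun f => hmono f (fun x _ hx => absurd (Finset.mem_univ _) hx)⟩

/-! ### Tree orientations and Descartes' construction -/

/-- An acyclic orientation of `G` of out-degree at most `D` in which the sets `anc w` of
ancestors of the distinct out-neighbours `w` of a vertex are disjoint. -/
structure TreeOrientation {V : Type*} (G : SimpleGraph V) (D : ℕ) where
  par : V → V → Prop
  anc : V → Set V
  level : V → ℕ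
  adj_iff : ∀ v w, G.Adj v w ↔ par v w ∨ par w v
  level_lt : ∀ v w, par v w → level w < level v
  self_mem : ∀ v, v ∈ anc v
  anc_subset : ∀ v w, par v w → anc w ⊆ anc v
  notMem_anc : ∀ v w, par v w → v ∉ anc w
  disjoint : ∀ v w w', par v w → par v w' → w ≠ w' → Disjoint (anc w) (anc w')
  encard_le : ∀ v, {w | par v w}.encard ≤ D

section Descartes

variable {V X J : Type*} {G : SimpleGraph V}

/-- The graph `G` with a pendant vertex attached to every vertex. -/
def pendantGraph (G : SimpleGraph V) : SimpleGraph (V ⊕ V) where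
  Adj
    | .inl v, .inr w => v = w
    | .inr v, .inl w => v = w
    | .inr v, .inr w => G.Adj v w
    | _, _ => False
  symm := ⟨by
    rintro (v | v) (w | w) h
    exacts [h, Eq.symm h, Eq.symm h, SimpleGraph.Adj.symm h]⟩
  loopless := ⟨by
    rintro (v | v) h
    exacts [h, G.irrefl h]⟩

theorem SimpleGraph.IsForestOn.pendantGraph {g : ℕ} (h : G.IsForestOn Set.univ g) :
    (pendantGraph G).IsForestOn Set.univ g := by
  intro U _ hne hg
  by_cases hU : ∃ v, Sum.inl v ∈ U
  · obtain ⟨v, hv⟩ := hU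
    refine ⟨_, hv, ?_⟩
    rintro (a | a) - (b | b) - ha hb
    · exact ha.elim
    · exact ha.elim
    · exact hb.elim
    · exact congrArg Sum.inr (Eq.trans (Eq.symm ha) hb)
  · refine h.of_reflects (s := Set.range Sum.inr) Sum.inr le_rfl (fun a b hab => hab) U ?_ hne hg
    rintro (v | v) hv
    · exact (hU ⟨v, hv⟩).elim
    · exact ⟨v, rfl⟩

/-- The parent relation of the Descartes graph: the copy of `G` with index `j` is matched to the
points `e j v`. -/
def descartesPar (par : V → V → Prop) (e : J → V → X) : X ⊕ (J × V) → X ⊕ (J × V) → Prop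
  | .inr (j, v), .inr (k, w) => j = k ∧ par v w
  | .inr (j, v), .inl x => x = e j v
  | _, _ => False

theorem descartesPar_iff {par : V → V → Prop} {e : J → V → X} {j : J} {v : V}
    {z : X ⊕ (J × V)} : descartesPar par e (.inr (j, v)) z ↔
      z = .inl (e j v) ∨ ∃ w, par v w ∧ z = .inr (j, w) := by
  rcases z with x | ⟨k, w⟩
  · simp [descartesPar]
  · simp only [descartesPar, reduceCtorEq, Sum.inr.injEq, Prod.mk.injEq, false_or]
    constructor
    · rintro ⟨rfl, h⟩
      exact ⟨w, h, rfl, rfl⟩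
    · rintro ⟨w', h, rfl, rfl⟩
      exact ⟨rfl, h⟩

/-- Disjoint copies of `G`, one for each edge `e j` of a hypergraph, matched to the
edges. -/
def descartesGraph (G : SimpleGraph V) (e : J → V → X) : SimpleGraph (X ⊕ (J × V)) where
  Adj z z' := descartesPar G.Adj e z z' ∨ descartesPar G.Adj e z' z
  symm := ⟨fun _ _ h => h.symm⟩
  loopless := ⟨by rintro (x | ⟨j, v⟩) h <;> simp [descartesPar] at h⟩

/-- Contracting the copies gives the incidence graph, and a copy with its matched points is a
pendant graph. Each copy vertex is matched to one point only, so sparsity `g` of the hypergraph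
suffices. -/
theorem descartesGraph_isForestOn {g : ℕ} {e : J → V → X} (he : ∀ j, Function.Injective (e j))
    (hG : G.IsForestOn Set.univ (g + 1)) (hI : (incidenceGraph e).IsForestOn Set.univ g) :
    (descartesGraph G e).IsForestOn Set.univ (g + 1) := by
  let β : X ⊕ (J × V) → X ⊕ J := Sum.map id Prod.fst
  refine SimpleGraph.IsForestOn.of_pieces (Y := incidenceGraph e) β (Set.range Sum.inl)
      ?_ ?_ incidenceGraph_bipartite ?_ hI ?_
  · have key : ∀ z z', descartesPar G.Adj e z z' →
        β z = β z' ∨ (incidenceGraph e).Adj (β z) (β z') := by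
      rintro (x | ⟨j, v⟩) (y | ⟨k, w⟩) h
      · exact h.elim
      · exact h.elim
      · exact Or.inr ⟨v, Eq.symm h⟩
      · exact Or.inl (congrArg Sum.inr h.1)
    rintro z z' (h | h)
    · exact key z z' h
    · exact (key z' z h).imp Eq.symm SimpleGraph.Adj.symm
  · rintro (x | z) (x' | z') hz hzz <;> simp_all [β]
  · rintro (z | ⟨j, v⟩) (x | x) (x' | x') hz hx hx' h h'
    all_goals simp_all [β, descartesGraph, descartesPar]
  · rintro (x | j) hm
    · exact (hm ⟨x, rfl⟩).elim
    · refine hG.pendantGraph.of_reflects (Sum.map (e j) (fun v => (j, v))) ?_ ?_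
      · rintro (x | ⟨k, v⟩) hz
        · rcases hz with hz | hz
          · simp [β] at hz
          · obtain ⟨r, hr⟩ := incidenceGraph_adj_right.mp hz
            exact ⟨.inl r, congrArg Sum.inl (Sum.inl_injective hr).symm⟩
        · rcases hz with hz | hz
          · obtain rfl : k = j := by simpa [β] using hz
            exact ⟨.inr v, rfl⟩
          · obtain ⟨r, hr⟩ := incidenceGraph_adj_right.mp hz
            simp [β] at hr
      · rintro (v | v) (w | w) (h | h)
        · exact h
        · exact h
        · exact h.elim
        · exact he j h
        · exact (he j h).symm
        · exact h.elim
        · exact h.2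
        · exact h.2.symm

/-- The copy matched to a monochromatic edge cannot use that edge's colour, which would leave `n`
colours for `G`. -/
theorem descartesGraph_not_colorable {n : ℕ} {e : J → V → X}
    (he : ∀ f : X → Fin (n + 1), ∃ j, ∀ r r', f (e j r) = f (e j r'))
    (hG : ¬ G.Colorable n) : ¬ (descartesGraph G e).Colorable (n + 1) := by
  rintro ⟨f⟩
  obtain ⟨j, hj⟩ := he fun x => f (.inl x)
  apply hG
  rcases isEmpty_or_nonempty V with hV | ⟨⟨v₀⟩⟩
  · exact SimpleGraph.Colorable.of_isEmpty n
  have hne : ∀ v, f (.inr (j, v)) ≠ f (.inl (e j v₀)) := by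
    intro v
    rw [hj v₀ v]
    exact f.valid (Or.inl rfl)
  let col : G.Coloring {c : Fin (n + 1) // c ≠ f (.inl (e j v₀))} :=
    SimpleGraph.Coloring.mk (fun v => ⟨f (.inr (j, v)), hne v⟩) (by
      intro v w hvw h
      exact f.valid (v := .inr (j, v)) (w := .inr (j, w)) (Or.inl ⟨rfl, hvw⟩)
        (Subtype.ext_iff.mp h))
  have := col.colorable
  simpa using this

/-- The orientation of the Descartes graph in which every copy of `G` points to the
hypergraph. -/
def TreeOrientation.descartes {D : ℕ} (T : TreeOrientation G D) {e : J → V → X}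
    (he : ∀ j, Function.Injective (e j)) : TreeOrientation (descartesGraph G e) (D + 1) where
  par := descartesPar T.par e
  -- A copy vertex reaches its old ancestors and the points matched to them; as `e j` is injective,
  -- disjoint branches stay disjoint.
  anc
    | .inl x => {.inl x}
    | .inr (j, v) => (fun a => .inr (j, a)) '' T.anc v ∪ (fun a => .inl (e j a)) '' T.anc v
  level
    | .inl _ => 0
    | .inr (_, v) => T.level v + 1
  adj_iff := by
    rintro (x | ⟨j, v⟩) (y | ⟨k, w⟩)
    · simp [descartesGraph, descartesPar]
    · simp [descartesGraph, descartesPar]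
    · simp [descartesGraph, descartesPar]
    · simp only [descartesGraph, descartesPar, T.adj_iff]
      tauto
  level_lt := by
    rintro (x | ⟨j, v⟩) (y | ⟨k, w⟩) h
    · exact h.elim
    · exact h.elim
    · exact Nat.succ_pos _
    · exact Nat.succ_lt_succ (T.level_lt _ _ h.2)
  self_mem := by
    rintro (x | ⟨j, v⟩)
    · rfl
    · exact Or.inl ⟨v, T.self_mem v, rfl⟩
  anc_subset := by
    rintro (x | ⟨j, v⟩) z h
    · exact h.elim
    · rcases descartesPar_iff.mp h with rfl | ⟨w, hw, rfl⟩
      · rintro _ rfl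
        exact Or.inr ⟨v, T.self_mem v, rfl⟩
      · exact Set.union_subset_union (Set.image_mono (T.anc_subset _ _ hw))
          (Set.image_mono (T.anc_subset _ _ hw))
  notMem_anc := by
    rintro (x | ⟨j, v⟩) z h
    · exact h.elim
    · rcases descartesPar_iff.mp h with rfl | ⟨w, hw, rfl⟩
      · simp
      · have := T.notMem_anc _ _ hw
        simpa using this
  disjoint := by
    have key : ∀ j v w, T.par v w → Disjoint {Sum.inl (e j v)}
        ((fun a => Sum.inr (j, a)) '' T.anc w ∪ (fun a => Sum.inl (e j a)) '' T.anc w :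
          Set (X ⊕ (J × V))) := by
      intro j v w hw
      rw [Set.disjoint_singleton_left]
      have := T.notMem_anc _ _ hw
      simpa [(he j).eq_iff] using this
    rintro (x | ⟨j, v⟩) z z' h h' hne
    · exact h.elim
    · rcases descartesPar_iff.mp h with rfl | ⟨w, hw, rfl⟩ <;>
        rcases descartesPar_iff.mp h' with rfl | ⟨w', hw', rfl⟩
      · exact (hne rfl).elim
      · exact key j v w' hw'
      · exact (key j v w hw).symm
      · have hd := T.disjoint v w w' hw hw' (by rintro rfl; exact hne rfl)
        rw [Set.disjoint_left] at hd ⊢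
        rintro _ (⟨a, ha, rfl⟩ | ⟨a, ha, rfl⟩)
        · simpa using hd ha
        · simpa [(he j).eq_iff] using hd ha
  encard_le := by
    rintro (x | ⟨j, v⟩)
    · simp [descartesPar]
    · have : {z | descartesPar T.par e (.inr (j, v)) z} =
          insert (.inl (e j v)) ((fun w => Sum.inr (j, w)) '' {w | T.par v w}) := by
        ext z
        rw [Set.mem_ofPred_eq, descartesPar_iff]
        simp [eq_comm]
      rw [this]
      refine (Set.encard_insert_le _ _).trans ?_
      push_cast
      gcongr
      exact (Set.encard_image_le _ _).trans (T.encard_le v)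

end Descartes

theorem exists_treeOrientation_not_colorable (g n : ℕ) :
    ∃ (V : Type) (_ : Finite V) (G : SimpleGraph V), ¬ G.Colorable n ∧
      G.IsForestOn Set.univ (g + 1) ∧ Nonempty (TreeOrientation G n) := by
  induction n with
  | zero =>
    refine ⟨Unit, inferInstance, ⊥, ?_, fun U _ hne _ => ?_, ⟨?_⟩⟩
    · rintro ⟨f⟩
      exact (f ()).elim0
    · obtain ⟨v, hv⟩ := hne
      exact ⟨v, hv, fun _ _ _ _ h => h.elim⟩
    · exact
        { par := fun _ _ => False
          anc := fun _ => Set.univ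
          level := fun _ => 0
          adj_iff := by simp
          level_lt := by simp
          self_mem := by simp
          anc_subset := by simp
          notMem_anc := by simp
          disjoint := by simp
          encard_le := by simp }
  | succ n ih =>
    obtain ⟨V, _, G, hcol, hforest, ⟨T⟩⟩ := ih
    obtain ⟨X, J, _, _, e, he, hI, hmono⟩ := hasSparseRamseyHypergraphs g V (Fin (n + 1))
    exact ⟨X ⊕ (J × V), inferInstance, descartesGraph G e, descartesGraph_not_colorable hmono hcol,
      descartesGraph_isForestOn he hforest hI, ⟨T.descartes he⟩⟩

/-! ### Independent Bernoulli variables on a finite set -/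

section Bernoulli

variable {W : Type*} [Fintype W]

/-- The weight of `ω` when the coordinates `ω x` are independent and true with
probability `q x`. -/
noncomputable def bernoulliWeight (q : W → ℝ) (ω : W → Bool) : ℝ :=
  ∏ x, if ω x then q x else 1 - q x

/-- The expectation of `f` when the coordinates are independent and true with
probability `q x`. -/
noncomputable def bernoulliExpect [DecidableEq W] (q : W → ℝ) (f : (W → Bool) → ℝ) : ℝ :=
  ∑ ω, bernoulliWeight q ω * f ω

theorem bernoulliWeight_nonneg {q : W → ℝ} (h0 : ∀ x, 0 ≤ q x) (h1 : ∀ x, q x ≤ 1)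
    (ω : W → Bool) : 0 ≤ bernoulliWeight q ω := by
  refine Finset.prod_nonneg fun x _ => ?_
  split_ifs
  · exact h0 x
  · exact sub_nonneg.mpr (h1 x)

variable [DecidableEq W]

theorem bernoulliExpect_prod_coord (q : W → ℝ) (h : W → Bool → ℝ) :
    bernoulliExpect q (fun ω => ∏ x, h x (ω x)) =
      ∏ x, (q x * h x true + (1 - q x) * h x false) := by
  have := Finset.prod_univ_sum (fun _ : W => (Finset.univ : Finset Bool))
    (fun x b => (if b then q x else 1 - q x) * h x b)
  rw [Fintype.piFinset_univ] at this
  simp only [bernoulliExpect, bernoulliWeight, ← Finset.prod_mul_distrib]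
  rw [← this]
  simp

theorem bernoulliExpect_one (q : W → ℝ) : bernoulliExpect q (fun _ => 1) = 1 := by
  simpa using bernoulliExpect_prod_coord q (fun _ _ => 1)

theorem bernoulliExpect_coord (q : W → ℝ) (x : W) :
    bernoulliExpect q (fun ω => if ω x then 1 else 0) = q x := by
  have := bernoulliExpect_prod_coord q (fun y b => if y = x then (if b then 1 else 0) else 1)
  simpa [Finset.prod_ite_eq', apply_ite, ite_add, add_ite, mul_ite] using this

theorem bernoulliExpect_add (q : W → ℝ) (f g : (W → Bool) → ℝ) :
    bernoulliExpect q (fun ω => f ω + g ω) = bernoulliExpect q f + bernoulliExpect q g := by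
  simp only [bernoulliExpect, mul_add, Finset.sum_add_distrib]

theorem bernoulliExpect_const_mul (q : W → ℝ) (c : ℝ) (f : (W → Bool) → ℝ) :
    bernoulliExpect q (fun ω => c * f ω) = c * bernoulliExpect q f := by
  simp only [bernoulliExpect, Finset.mul_sum]
  exact Finset.sum_congr rfl fun ω _ => by ring

theorem bernoulliExpect_const (q : W → ℝ) (c : ℝ) : bernoulliExpect q (fun _ => c) = c := by
  simpa [bernoulliExpect_one] using bernoulliExpect_const_mul q c (fun _ => 1)

theorem bernoulliExpect_sum {ι : Type*} (q : W → ℝ) (s : Finset ι) (f : ι → (W → Bool) → ℝ) :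
    bernoulliExpect q (fun ω => ∑ i ∈ s, f i ω) = ∑ i ∈ s, bernoulliExpect q (f i) := by
  simp only [bernoulliExpect, Finset.mul_sum]
  exact Finset.sum_comm

theorem bernoulliExpect_mono {q : W → ℝ} (h0 : ∀ x, 0 ≤ q x) (h1 : ∀ x, q x ≤ 1)
    {f g : (W → Bool) → ℝ} (h : ∀ ω, f ω ≤ g ω) :
    bernoulliExpect q f ≤ bernoulliExpect q g :=
  Finset.sum_le_sum fun ω _ => mul_le_mul_of_nonneg_left (h ω) (bernoulliWeight_nonneg h0 h1 ω)

/-- Take two independent samples and exchange their coordinates outside `A`. The joint weight is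
unchanged, while `f ω * g ω` becomes a product over separate samples. -/
theorem bernoulliExpect_mul (q : W → ℝ) {f g : (W → Bool) → ℝ} {A B : Set W}
    (hf : DependsOn f A) (hg : DependsOn g B) (hAB : Disjoint A B) :
    bernoulliExpect q (fun ω => f ω * g ω) = bernoulliExpect q f * bernoulliExpect q g := by
  classical
  let σ : (W → Bool) × (W → Bool) → (W → Bool) × (W → Bool) := fun p =>
    (fun x => if x ∈ A then p.1 x else p.2 x, fun x => if x ∈ A then p.2 x else p.1 x)
  have hσ : Function.Involutive σ := by
    intro p
    ext x <;> by_cases hx : x ∈ A <;> simp [σ, hx]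
  have hw : ∀ p, bernoulliWeight q (σ p).1 * bernoulliWeight q (σ p).2 =
      bernoulliWeight q p.1 * bernoulliWeight q p.2 := by
    intro p
    simp only [bernoulliWeight, ← Finset.prod_mul_distrib]
    refine Finset.prod_congr rfl fun x _ => ?_
    by_cases hx : x ∈ A
    · simp only [σ, hx, if_true]
    · simp only [σ, hx, if_false]
      exact mul_comm _ _
  have hf' : ∀ p, f (σ p).1 = f p.1 := fun p => hf fun x hx => by simp [σ, hx]
  have hg' : ∀ p, g (σ p).1 = g p.2 := fun p => hg fun x hx => by
    simp [σ, Set.disjoint_right.mp hAB hx]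
  calc bernoulliExpect q (fun ω => f ω * g ω)
      = bernoulliExpect q (fun ω => f ω * g ω) * bernoulliExpect q (fun _ => 1) := by
        rw [bernoulliExpect_one, mul_one]
    _ = ∑ p : (W → Bool) × (W → Bool),
          bernoulliWeight q p.1 * bernoulliWeight q p.2 * (f p.1 * g p.1) := by
        simp only [bernoulliExpect]
        rw [Finset.sum_mul_sum, ← Finset.sum_product', Finset.univ_product_univ]
        exact Finset.sum_congr rfl fun p _ => by ring
    _ = ∑ p : (W → Bool) × (W → Bool),
          bernoulliWeight q p.1 * bernoulliWeight q p.2 * (f p.1 * g p.2) := by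
        rw [← Equiv.sum_comp hσ.toPerm]
        refine Finset.sum_congr rfl fun p _ => ?_
        rw [Function.Involutive.coe_toPerm, hw, hf', hg']
    _ = bernoulliExpect q f * bernoulliExpect q g := by
        simp only [bernoulliExpect]
        rw [Finset.sum_mul_sum, ← Finset.sum_product', Finset.univ_product_univ]
        exact Finset.sum_congr rfl fun p _ => by ring

theorem bernoulliExpect_prod {ι : Type*} (q : W → ℝ) (s : Finset ι) {f : ι → (W → Bool) → ℝ}
    {A : ι → Set W} (hf : ∀ i ∈ s, DependsOn (f i) (A i))
    (hA : ∀ i ∈ s, ∀ j ∈ s, i ≠ j → Disjoint (A i) (A j)) :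
    bernoulliExpect q (fun ω => ∏ i ∈ s, f i ω) = ∏ i ∈ s, bernoulliExpect q (f i) := by
  classical
  induction s using Finset.induction_on with
  | empty => simpa using bernoulliExpect_one q
  | insert i s hi ih =>
    simp only [Finset.prod_insert hi]
    rw [← ih (fun j hj => hf j (Finset.mem_insert_of_mem hj)) (fun j hj k hk =>
      hA j (Finset.mem_insert_of_mem hj) k (Finset.mem_insert_of_mem hk))]
    refine bernoulliExpect_mul q (A := A i) (B := ⋃ j ∈ s, A j)
      (hf i (Finset.mem_insert_self _ _)) ?_ ?_
    · intro ω ω' h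
      refine Finset.prod_congr rfl fun j hj => hf j (Finset.mem_insert_of_mem hj) fun x hx => ?_
      exact h x (Set.mem_biUnion hj hx)
    · rw [Set.disjoint_iUnion₂_right]
      intro j hj
      exact hA i (Finset.mem_insert_self _ _) j (Finset.mem_insert_of_mem hj)
        (by rintro rfl; exact hi hj)

end Bernoulli

/-! ### Random greedy selection -/

section Greedy

variable {W : Type*}

/-- The elements selected greedily, in order of increasing level: `x` is selected if `ω x` holds
and no `r`-successor of `x` has been selected. -/
def GreedySelected (r : W → W → Prop) (level : W → ℕ) (ω : W → Bool) : W → Prop :=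
  (measure level).wf.fix fun x ih => ω x = true ∧ ∀ y, r x y → ∀ h : level y < level x, ¬ ih y h

variable {r : W → W → Prop} {level : W → ℕ}

theorem greedySelected_iff (hr : ∀ x y, r x y → level y < level x)
    (ω : W → Bool) (x : W) : GreedySelected r level ω x ↔
    ω x = true ∧ ∀ y, r x y → ¬ GreedySelected r level ω y := by
  rw [GreedySelected, WellFounded.fix_eq]
  exact and_congr_right fun _ => forall₂_congr fun y hy => forall_prop_of_true (hr x y hy)

theorem greedySelected_dependsOn (hr : ∀ x y, r x y → level y < level x) (x : W) :
    DependsOn (fun ω => GreedySelected r level ω x) {y | Relation.ReflTransGen r x y} := by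
  induction hn : level x using Nat.strong_induction_on generalizing x with
  | _ n ih =>
  intro ω ω' h
  simp only [eq_iff_iff]
  rw [greedySelected_iff hr, greedySelected_iff hr, h x Relation.ReflTransGen.refl]
  refine and_congr_right fun _ => forall₂_congr fun y hy => not_congr ?_
  rw [← eq_iff_iff]
  exact ih (level y) (hn ▸ hr x y hy) y rfl
    fun z hz => h z (Relation.ReflTransGen.head hy hz)

open Classical in
-- Activation of `x` and rejection of each successor depend on disjoint sets of coordinates, so the
-- probability is `q x` times one factor `1 - p` per successor; `q` is chosen to cancel these
-- factors.
theorem bernoulliExpect_greedySelected [Fintype W]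
    (hr : ∀ x y, r x y → level y < level x) {p : ℝ} (hp : p < 1)
    (hself : ∀ x y, r x y → ¬ Relation.ReflTransGen r y x)
    (hdisj : ∀ x y y', r x y → r x y' → y ≠ y' →
      Disjoint {z | Relation.ReflTransGen r y z} {z | Relation.ReflTransGen r y' z})
    {q : W → ℝ} (hq : ∀ x, q x = p / (1 - p) ^ (Finset.univ.filter (r x)).card) (x : W) :
    bernoulliExpect q (fun ω => if GreedySelected r level ω x then 1 else 0) = p := by
  induction hn : level x using Nat.strong_induction_on generalizing x with
  | _ n ih =>
  have hdep : ∀ y, DependsOn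
      (fun ω : W → Bool => (1 : ℝ) + (-1) * if GreedySelected r level ω y then 1 else 0)
      {z | Relation.ReflTransGen r y z} := by
    intro y ω ω' h
    have : GreedySelected r level ω y = GreedySelected r level ω' y :=
      greedySelected_dependsOn hr y h
    simp only [this]
  have heq : (fun ω : W → Bool => (if GreedySelected r level ω x then 1 else 0 : ℝ)) =
      fun ω => (if ω x then 1 else 0) * ∏ y ∈ Finset.univ.filter (r x),
        ((1 : ℝ) + (-1) * if GreedySelected r level ω y then 1 else 0) := by
    funext ω
    by_cases hx : GreedySelected r level ω x
    · have h := (greedySelected_iff hr ω x).mp hx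
      rw [if_pos hx, if_pos h.1, Finset.prod_eq_one, one_mul]
      intro y hy
      rw [if_neg (h.2 y (Finset.mem_filter.mp hy).2)]
      simp
    · rw [if_neg hx]
      by_cases hω : ω x = true
      · have : ∃ y, r x y ∧ GreedySelected r level ω y := by
          by_contra hno
          push Not at hno
          exact hx ((greedySelected_iff hr ω x).mpr ⟨hω, hno⟩)
        obtain ⟨y, hy, hyS⟩ := this
        rw [Finset.prod_eq_zero (i := y) (by simpa using hy) (by simp [hyS]), mul_zero]
      · rw [if_neg hω, zero_mul]
  rw [heq, bernoulliExpect_mul q (A := {x}) (B := ⋃ y ∈ Finset.univ.filter (r x),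
      {z | Relation.ReflTransGen r y z}), bernoulliExpect_coord,
    bernoulliExpect_prod q _ (fun y _ => hdep y)]
  · have hE : ∀ y ∈ Finset.univ.filter (r x), bernoulliExpect q (fun ω => (1 : ℝ) +
        (-1) * if GreedySelected r level ω y then 1 else 0) = 1 - p := by
      intro y hy
      have hxy := (Finset.mem_filter.mp hy).2
      rw [bernoulliExpect_add, bernoulliExpect_const_mul, bernoulliExpect_one,
        ih (level y) (hn ▸ hr x y hxy) y rfl]
      ring
    rw [Finset.prod_congr rfl hE, Finset.prod_const, hq]
    exact div_mul_cancel₀ _ (pow_ne_zero _ (by linarith))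
  · intro y hy y' hy' hne
    exact hdisj x y y' (Finset.mem_filter.mp hy).2 (Finset.mem_filter.mp hy').2 hne
  · intro ω ω' h
    simp only [h x rfl]
  · intro ω ω' h
    exact Finset.prod_congr rfl fun y hy => hdep y fun z hz => h z (Set.mem_biUnion hy hz)
  · rw [Set.disjoint_iUnion₂_right]
    intro y hy
    rw [Set.disjoint_singleton_left]
    exact hself x y (Finset.mem_filter.mp hy).2

open Classical in
-- Second moment, summed over all lists: pairwise independence within a list kills the off-diagonal
-- terms, so the expected sum of squared deviations is at most `|ι| * k * p`.
theorem exists_independent_set_large_inter [Fintype W] {ι : Type*} [Fintype ι]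
    (hr : ∀ x y, r x y → level y < level x)
    (hself : ∀ x y, r x y → ¬ Relation.ReflTransGen r y x)
    (hdisj : ∀ x y y', r x y → r x y' → y ≠ y' →
      Disjoint {z | Relation.ReflTransGen r y z} {z | Relation.ReflTransGen r y' z})
    {D : ℕ} (hD : ∀ x, (Finset.univ.filter (r x)).card ≤ D) {p δ : ℝ} (hp0 : 0 < p) (hp1 : p < 1)
    (hpD : p ≤ (1 - p) ^ D) (hδ : 0 < δ) {k : ℕ} (L : ι → Finset W) (hL : ∀ u, (L u).card = k)
    (hdisjL : ∀ u, ∀ x ∈ L u, ∀ x' ∈ L u, x ≠ x' →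
      Disjoint {z | Relation.ReflTransGen r x z} {z | Relation.ReflTransGen r x' z})
    (hk : (Fintype.card ι : ℝ) < δ ^ 2 * p * k) :
    ∃ S : Set W, (∀ x ∈ S, ∀ y ∈ S, ¬ r x y) ∧
      ∀ u, (1 - δ) * p * k ≤ ((S ∩ L u : Set W).ncard : ℝ) := by
  let q : W → ℝ := fun x => p / (1 - p) ^ (Finset.univ.filter (r x)).card
  have hp1' : 0 < 1 - p := by linarith
  have hq0 : ∀ x, 0 ≤ q x := fun x => by positivity
  have hq1 : ∀ x, q x ≤ 1 := fun x => by
    refine div_le_one_of_le₀ (hpD.trans ?_) (by positivity)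
    exact pow_le_pow_of_le_one hp1'.le (by linarith) (hD x)
  let ind : W → (W → Bool) → ℝ := fun x ω => if GreedySelected r level ω x then 1 else 0
  have hind : ∀ x, bernoulliExpect q (ind x) = p :=
    bernoulliExpect_greedySelected hr hp1 hself hdisj fun _ => rfl
  have hcentered : ∀ x, bernoulliExpect q (fun ω => ind x ω + -p) = 0 := by
    intro x
    rw [bernoulliExpect_add, hind, bernoulliExpect_const]
    ring
  have hdep : ∀ x, DependsOn (fun ω => ind x ω + -p) {z | Relation.ReflTransGen r x z} := by
    intro x ω ω' h
    have : GreedySelected r level ω x = GreedySelected r level ω' x :=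
      greedySelected_dependsOn hr x h
    simp only [ind, this]
  have hvar : ∀ x, bernoulliExpect q (fun ω => (ind x ω + -p) * (ind x ω + -p)) ≤ p := by
    intro x
    have : (fun ω => (ind x ω + -p) * (ind x ω + -p)) =
        fun ω => (1 - 2 * p) * ind x ω + p ^ 2 := by
      funext ω
      by_cases h : GreedySelected r level ω x <;> simp [ind, h] <;> ring
    rw [this, bernoulliExpect_add, bernoulliExpect_const_mul, hind, bernoulliExpect_const]
    nlinarith
  have hcov : ∀ u, ∀ x ∈ L u, ∑ x' ∈ L u,
      bernoulliExpect q (fun ω => (ind x ω + -p) * (ind x' ω + -p)) ≤ p := by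
    intro u x hx
    rw [Finset.sum_eq_single_of_mem x hx]
    · exact hvar x
    · intro x' hx' hne
      rw [bernoulliExpect_mul q (hdep x) (hdep x') (hdisjL u x hx x' hx' hne.symm), hcentered,
        zero_mul]
  have htotal : bernoulliExpect q (fun ω => ∑ u, ∑ x ∈ L u, ∑ x' ∈ L u,
      (ind x ω + -p) * (ind x' ω + -p)) ≤ Fintype.card ι * (k * p) := by
    simp only [bernoulliExpect_sum]
    refine (Finset.sum_le_sum (g := fun _ => k * p) fun u _ => ?_).trans (by simp)
    refine (Finset.sum_le_sum (hcov u)).trans ?_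
    simp [hL u]
  by_contra hno
  push Not at hno
  -- If every outcome failed, some list would always fall short of its mean by more than `δ * p *
  -- k`, and its square alone would give this bound.
  have hlower : ∀ ω, (δ * p * k) ^ 2 ≤ ∑ u, ∑ x ∈ L u, ∑ x' ∈ L u,
      (ind x ω + -p) * (ind x' ω + -p) := by
    intro ω
    obtain ⟨u, hu⟩ := hno {x | GreedySelected r level ω x}
      fun x hx y hy hxy => ((greedySelected_iff hr ω x).mp hx).2 y hxy hy
    simp only [← Finset.mul_sum, ← Finset.sum_mul]
    refine le_trans ?_ (Finset.single_le_sum (f := fun u =>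
      (∑ x ∈ L u, (ind x ω + -p)) * ∑ x ∈ L u, (ind x ω + -p))
      (fun u _ => mul_self_nonneg _) (Finset.mem_univ u))
    have hN : ∑ x ∈ L u, (ind x ω + -p) =
        (({x | GreedySelected r level ω x} ∩ L u : Set W).ncard : ℝ) - k * p := by
      have : ({x | GreedySelected r level ω x} ∩ L u : Set W) =
          ((L u).filter fun x => GreedySelected r level ω x : Finset W) := by
        ext x
        simp [and_comm]
      rw [this, Set.ncard_coe_finset, Finset.sum_add_distrib, Finset.sum_const, hL u,
        Finset.sum_boole]
      simp only [nsmul_eq_mul]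
      ring
    have h0 : 0 ≤ δ * p * k := by positivity
    rw [hN]
    nlinarith
  have h1 := bernoulliExpect_mono hq0 hq1 hlower
  rw [bernoulliExpect_const] at h1
  have hk0 : 0 < (k : ℝ) := by
    rcases Nat.eq_zero_or_pos k with rfl | h
    · have : (0 : ℝ) ≤ Fintype.card ι := Nat.cast_nonneg _
      simp at hk
      linarith
    · exact_mod_cast h
  have h2 : (Fintype.card ι : ℝ) * (k * p) < δ ^ 2 * p * k * (k * p) :=
    mul_lt_mul_of_pos_right hk (by positivity)
  nlinarith

end Greedy

/-! ### Lifting the orientation to a cover -/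

section Cover

variable {V : Type*} {G : SimpleGraph V} {D : ℕ}

namespace TreeOrientation

variable {W : Type*} (T : TreeOrientation G D) (C : DPCover G W) (u : W → V)

/-- The lift of the orientation of `G` to the cross-edges of a cover, `u x` being the vertex whose
list contains `x`. -/
def lift (x y : W) : Prop := T.par (u x) (u y) ∧ C.H.Adj x y

variable {T C u}

theorem mem_anc_of_lift {x y : W} (h : Relation.ReflTransGen (T.lift C u) x y) :
    u y ∈ T.anc (u x) := by
  induction h using Relation.ReflTransGen.head_induction_on with
  | refl => exact T.self_mem _
  | head h _ ih => exact T.anc_subset _ _ h.1 ih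

theorem not_reflTransGen_lift {x y : W} (h : T.lift C u x y) :
    ¬ Relation.ReflTransGen (T.lift C u) y x :=
  fun hyx => T.notMem_anc _ _ h.1 (mem_anc_of_lift hyx)

theorem eq_of_lift (hu : ∀ x, x ∈ C.L (u x)) {x y y' : W} (h : T.lift C u x y)
    (h' : T.lift C u x y') (he : u y = u y') :
    y = y' :=
  C.matching _ _ ((T.adj_iff _ _).mpr (Or.inl h.1)) x (hu x) y (hu y) y' (he ▸ hu y') h.2 h'.2

theorem disjoint_lift (hu : ∀ x, x ∈ C.L (u x)) {x y y' : W} (h : T.lift C u x y)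
    (h' : T.lift C u x y') (hne : y ≠ y') :
    Disjoint {z | Relation.ReflTransGen (T.lift C u) y z}
      {z | Relation.ReflTransGen (T.lift C u) y' z} := by
  rw [Set.disjoint_left]
  intro z hz hz'
  exact Set.disjoint_left.mp
    (T.disjoint _ _ _ h.1 h'.1 fun he => hne (eq_of_lift hu h h' he))
    (mem_anc_of_lift hz) (mem_anc_of_lift hz')

/-- Two paths from one list to a common end must take their first steps into the same list, since
different out-neighbours have disjoint ancestor sets. The matching condition, read backwards, keeps
the new elements distinct, and the level has dropped. -/
theorem disjoint_lift_of_eq (hu : ∀ x, x ∈ C.L (u x)) {x x' : W} (he : u x = u x') (hne : x ≠ x') :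
    Disjoint {z | Relation.ReflTransGen (T.lift C u) x z}
      {z | Relation.ReflTransGen (T.lift C u) x' z} := by
  rw [Set.disjoint_left]
  intro z hz hz'
  induction hn : T.level (u x) using Nat.strong_induction_on generalizing x x' with
  | _ n ih =>
  rcases Relation.ReflTransGen.cases_head hz with rfl | ⟨y, hxy, hyz⟩
  · rcases Relation.ReflTransGen.cases_head hz' with rfl | ⟨y', hxy', hyz'⟩
    · exact hne rfl
    · exact T.notMem_anc _ _ hxy'.1 (he ▸ mem_anc_of_lift hyz')
  · rcases Relation.ReflTransGen.cases_head hz' with rfl | ⟨y', hxy', hyz'⟩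
    · exact T.notMem_anc _ _ hxy.1 (he ▸ mem_anc_of_lift hyz)
    · have huy : u y = u y' := by
        by_contra h
        exact Set.disjoint_left.mp (T.disjoint _ _ _ hxy.1 (he ▸ hxy'.1) h)
          (mem_anc_of_lift hyz) (mem_anc_of_lift hyz')
      refine ih _ (hn ▸ T.level_lt _ _ hxy.1) huy ?_ hyz hyz' rfl
      rintro rfl
      exact hne (C.matching (u y) (u x) ((T.adj_iff _ _).mpr (Or.inr hxy.1)) y (hu y) x (hu x) x'
        (he ▸ hu x') hxy.2.symm hxy'.2.symm)

open Classical in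
theorem card_lift_le [Fintype W] (hu : ∀ x, x ∈ C.L (u x)) (x : W) :
    (Finset.univ.filter (T.lift C u x)).card ≤ D := by
  have h : (u '' {y | T.lift C u x y}).encard ≤ D :=
    (Set.encard_le_encard (by rintro _ ⟨y, hy, rfl⟩; exact hy.1)).trans (T.encard_le (u x))
  have hinj : Set.InjOn u {y | T.lift C u x y} := fun y hy y' hy' he => eq_of_lift hu hy hy' he
  rw [hinj.encard_image] at h
  have h' : ((Finset.univ.filter (T.lift C u x) : Finset W) : Set W) = {y | T.lift C u x y} := by
    ext y
    simp
  rw [← h', Set.encard_coe_eq_coe_finsetCard] at h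
  exact_mod_cast h

end TreeOrientation

theorem TreeOrientation.exists_isFracColoring [Finite V] (T : TreeOrientation G D) {p δ : ℝ}
    (hp0 : 0 < p) (hp1 : p < 1) (hpD : p ≤ (1 - p) ^ D) (hδ : 0 < δ) {k : ℕ}
    (hk : (Nat.card V : ℝ) < δ ^ 2 * p * k) {W : Type*} [Finite W] (C : DPCover G W)
    (hC : C.IsFold k) : ∃ S : Set W, C.IsFracColoring ((1 - δ) * p) S := by
  classical
  have := Fintype.ofFinite V
  have := Fintype.ofFinite W
  choose u hu huniq using C.partition
  have huniq : ∀ x v, x ∈ C.L v → v = u x := fun x v h => huniq x v h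
  obtain ⟨S, hS, hSL⟩ := exists_independent_set_large_inter (r := T.lift C u)
    (level := fun x => T.level (u x)) (fun x y h => T.level_lt _ _ h.1)
    (fun x y h => not_reflTransGen_lift h) (fun x y y' h h' hne => disjoint_lift hu h h' hne)
    (card_lift_le hu) hp0 hp1 hpD hδ (fun v => (C.L v).toFinset)
    (fun v => by rw [← Set.ncard_eq_toFinset_card']; exact hC v)
    (fun v x hx x' hx' hne => disjoint_lift_of_eq hu
      ((huniq x v (by simpa using hx)).symm.trans (huniq x' v (by simpa using hx'))) hne)
    (by rwa [← Nat.card_eq_fintype_card])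
  refine ⟨S, ?_, fun v => ?_⟩
  · rintro x hx y hy ⟨hxy, a, b, hab, hxa, hyb⟩
    have hadj := (C.eq_or_adj a b x hxa y hyb hxy).resolve_left hab
    rw [huniq x a hxa, huniq y b hyb, T.adj_iff] at hadj
    rcases hadj with h | h
    · exact hS x hx y hy ⟨h, hxy⟩
    · exact hS y hy x hx ⟨h, hxy.symm⟩
  · rw [hC v]
    simpa using hSL v

theorem TreeOrientation.fracDPChromaticNumber_le [Finite V] (T : TreeOrientation G D) {p δ : ℝ}
    (hp0 : 0 < p) (hp1 : p < 1) (hpD : p ≤ (1 - p) ^ D) (hδ : 0 < δ) (hδ1 : δ < 1) :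
    fracDPChromaticNumber G ≤ ENNReal.ofReal ((1 - δ) * p)⁻¹ := by
  obtain ⟨k, hk⟩ := exists_nat_gt ((Nat.card V : ℝ) / (δ ^ 2 * p))
  rw [div_lt_iff₀' (by positivity)] at hk
  have hk0 : 0 < k := by
    rcases Nat.eq_zero_or_pos k with rfl | h
    · have : (0 : ℝ) ≤ Nat.card V := Nat.cast_nonneg _
      simp at hk
      linarith
    · exact h
  have hpos : 0 < (1 - δ) * p := mul_pos (by linarith) hp0
  have hθ : (1 - δ) * p ≤ thetaDP G k := by
    refine le_csSup ⟨1, fun η hη => hη.1.2⟩ ⟨⟨hpos.le, ?_⟩, fun W _ C hC =>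
      T.exists_isFracColoring hp0 hp1 hpD hδ hk C hC⟩
    nlinarith
  refine (iInf_le _ (⟨k, hk0⟩ : ℕ+)).trans ?_
  rw [ENNReal.ofReal_inv_of_pos hpos]
  exact ENNReal.inv_le_inv.mpr (ENNReal.ofReal_le_ofReal hθ)

end Cover

/-! ### The choice of p -/

section Asymptotics

open Filter

theorem inv_succ_le_one_sub_pow (d : ℕ) :
    (1 / ((d : ℝ) + 1)) ≤ (1 - 1 / ((d : ℝ) + 1)) ^ d := by
  have h := one_add_mul_le_pow (a := -(1 / ((d : ℝ) + 1))) (by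
    have : 1 / ((d : ℝ) + 1) ≤ 1 := by
      rw [div_le_one (by positivity)]
      linarith [(Nat.cast_nonneg d : (0 : ℝ) ≤ d)]
    linarith) d
  calc (1 / ((d : ℝ) + 1)) = 1 + d * -(1 / ((d : ℝ) + 1)) := by
        field_simp
        ring
    _ ≤ (1 + -(1 / ((d : ℝ) + 1))) ^ d := h
    _ = _ := by rw [← sub_eq_add_neg]

theorem tendsto_log_div_natCast : Tendsto (fun d : ℕ => Real.log d / d) atTop (nhds 0) := by
  have := Real.isLittleO_log_id_atTop.tendsto_div_nhds_zero
  exact this.comp tendsto_natCast_atTop_atTop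

/-- With p = (1 - δ) ln d / d, the bound ln(1 - p) ≥ -p / (1 - p) gives (1 - p) ^ d ≥ d ^ (δ/2) / d,
which eventually exceeds ln d / d. -/
theorem eventually_le_one_sub_pow {δ : ℝ} (hδ : 0 < δ) (hδ1 : δ < 1) :
    ∀ᶠ d : ℕ in atTop, (1 - δ) * (Real.log d / d) < 1 ∧
      (1 - δ) * (Real.log d / d) ≤ (1 - (1 - δ) * (Real.log d / d)) ^ d := by
  have hsmall : ∀ᶠ d : ℕ in atTop, Real.log d / d < δ / 2 :=
    tendsto_log_div_natCast.eventually (gt_mem_nhds (by positivity))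
  have hlog : ∀ᶠ d : ℕ in atTop, Real.log d ≤ (d : ℝ) ^ (δ / 2) := by
    have h := (isLittleO_log_rpow_atTop (r := δ / 2) (by positivity)).bound one_pos
    filter_upwards [tendsto_natCast_atTop_atTop.eventually h, eventually_ge_atTop 1] with d hd h1
    have h1' : (1 : ℝ) ≤ d := by exact_mod_cast h1
    rw [one_mul, Real.norm_of_nonneg (Real.log_nonneg h1'),
      Real.norm_of_nonneg (by positivity)] at hd
    exact hd
  filter_upwards [hsmall, hlog, eventually_ge_atTop 1] with d hs hl h1
  have h1' : (1 : ℝ) ≤ d := by exact_mod_cast h1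
  have hd0 : (0 : ℝ) < d := by linarith
  have hlog0 := Real.log_nonneg h1'
  set t := Real.log d / d with ht
  have ht0 : 0 ≤ t := by positivity
  have htd : d * t = Real.log d := by rw [ht]; field_simp
  set p := (1 - δ) * t with hp
  have hp0 : 0 ≤ p := mul_nonneg (by linarith) ht0
  have hpt : p ≤ t := by nlinarith
  have hp1 : 0 < 1 - p := by linarith
  refine ⟨by linarith, ?_⟩
  have hexp : Real.exp (-(1 - δ / 2) * Real.log d) ≤ (1 - p) ^ d := by
    rw [← Real.exp_log (pow_pos hp1 d), Real.exp_le_exp, Real.log_pow]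
    have h2 := Real.one_sub_inv_le_log_of_pos hp1
    have h3 : -(1 - δ / 2) * t ≤ 1 - (1 - p)⁻¹ := by
      have : 1 - (1 - p)⁻¹ = -p / (1 - p) := by field_simp; ring
      rw [this, le_div_iff₀ hp1, hp]
      have : (1 - δ) ≤ (1 - δ / 2) * (1 - p) := by nlinarith
      nlinarith
    calc -(1 - δ / 2) * Real.log d = d * (-(1 - δ / 2) * t) := by rw [← htd]; ring
      _ ≤ d * Real.log (1 - p) := mul_le_mul_of_nonneg_left (h3.trans h2) hd0.le
  refine hpt.trans (le_trans ?_ hexp)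
  have : Real.exp (-(1 - δ / 2) * Real.log d) = (d : ℝ) ^ (δ / 2) / d := by
    rw [Real.rpow_def_of_pos hd0, show -(1 - δ / 2) * Real.log d =
      Real.log d * (δ / 2) - Real.log d by ring, Real.exp_sub, Real.exp_log hd0]
  rw [this, ht]
  gcongr

/-- Selection probabilities that are asymptotically at least `ln d / d`. -/
theorem exists_selection_probability :
    ∃ (p : ℕ → ℝ) (ε : ℕ → ℝ), Tendsto ε atTop (nhds 0) ∧ ∀ d : ℕ, 2 ≤ d →
      0 < p d ∧ p d < 1 ∧ p d ≤ (1 - p d) ^ d ∧ (p d)⁻¹ ≤ (1 + ε d) * (d / Real.log d) := by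
  -- The errors achievable at `d`; taking their infimum replaces a diagonal choice of δ depending on
  -- `d`.
  let s : ℕ → Set ℝ := fun d => {ε | 0 ≤ ε ∧ ∃ p : ℝ, 0 < p ∧ p < 1 ∧ p ≤ (1 - p) ^ d ∧
    p⁻¹ ≤ (1 + ε) * (d / Real.log d)}
  have hlogpos : ∀ d : ℕ, 2 ≤ d → 0 < Real.log d / d := fun d hd => by
    have : (1 : ℝ) < d := by exact_mod_cast hd
    have := Real.log_pos this
    positivity
  have hbdd : ∀ d, BddBelow (s d) := fun d => ⟨0, fun ε h => h.1⟩
  have hne : ∀ d : ℕ, 2 ≤ d → (s d).Nonempty := by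
    intro d hd
    have hd' : (2 : ℝ) ≤ d := by exact_mod_cast hd
    have hl := hlogpos d hd
    refine ⟨(d + 1) * (Real.log d / d), by positivity, 1 / ((d : ℝ) + 1), by positivity, ?_,
      inv_succ_le_one_sub_pow d, ?_⟩
    · rw [div_lt_one (by positivity)]
      linarith
    · have hl' : (d : ℝ) / Real.log d = (Real.log d / d)⁻¹ := (inv_div _ _).symm
      rw [hl', one_div, inv_inv, add_mul, mul_assoc, mul_inv_cancel₀ hl.ne']
      have : 0 < (Real.log d / d)⁻¹ := inv_pos.mpr hl
      linarith
  -- The infimum need not be attained, hence the vanishing extra term.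
  let ε : ℕ → ℝ := fun d => sInf (s d) + 1 / ((d : ℝ) + 1)
  have hex : ∀ d : ℕ, 2 ≤ d → ∃ p : ℝ, 0 < p ∧ p < 1 ∧ p ≤ (1 - p) ^ d ∧
      p⁻¹ ≤ (1 + ε d) * (d / Real.log d) := by
    intro d hd
    obtain ⟨ε', ⟨-, p, h0, h1, h2, h3⟩, hlt⟩ := exists_lt_of_csInf_lt (hne d hd)
      (show sInf (s d) < ε d from lt_add_of_pos_right _ (by positivity))
    refine ⟨p, h0, h1, h2, h3.trans ?_⟩
    have : 0 ≤ (d : ℝ) / Real.log d := by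
      rw [← inv_div]
      exact (inv_pos.mpr (hlogpos d hd)).le
    exact mul_le_mul_of_nonneg_right (by linarith) this
  choose! p hp using hex
  refine ⟨p, ε, ?_, hp⟩
  have hinf : Tendsto (fun d => sInf (s d)) atTop (nhds 0) := by
    rw [Metric.tendsto_atTop']
    intro γ hγ
    -- This δ satisfies (1 - δ)⁻¹ = 1 + γ / 2.
    have hδ0 : 0 < (γ / 2) / (1 + γ / 2) := by positivity
    have hδ1 : (γ / 2) / (1 + γ / 2) < 1 := by
      rw [div_lt_one (by positivity)]
      linarith
    have hδinv : 1 - (γ / 2) / (1 + γ / 2) = (1 + γ / 2)⁻¹ := by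
      field_simp
      ring
    obtain ⟨N, hN⟩ := eventually_atTop.mp
      ((eventually_le_one_sub_pow hδ0 hδ1).and (eventually_ge_atTop 2))
    refine ⟨N, fun d hd => ?_⟩
    obtain ⟨⟨h1, h2⟩, hd2⟩ := hN d hd.le
    have hl := hlogpos d hd2
    rw [hδinv] at h1 h2
    have hmem : γ / 2 ∈ s d := by
      refine ⟨by positivity, (1 + γ / 2)⁻¹ * (Real.log d / d), by positivity, h1, h2, ?_⟩
      rw [mul_inv, inv_inv, inv_div]
    have hle := csInf_le (hbdd d) hmem
    have hge : 0 ≤ sInf (s d) := le_csInf (hne d hd2) fun ε h => h.1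
    rw [Real.dist_eq, sub_zero, abs_of_nonneg hge]
    linarith
  simpa [ε] using hinf.add tendsto_one_div_add_atTop_nhds_zero_nat

end Asymptotics

/-! ### Assembly -/

theorem corollary1p8 :
    ∃ ε : ℕ → ℝ, Filter.Tendsto ε Filter.atTop (nhds 0) ∧
      ∀ d g : ℕ, 1 ≤ d → 1 ≤ g →
        ∃ (V : Type) (_ : Finite V) (G : SimpleGraph V),
          (d : ℕ∞) ≤ G.chromaticNumber ∧ (g : ℕ∞) ≤ G.egirth ∧
          (2 ≤ d → fracDPChromaticNumber G ≤
            ENNReal.ofReal ((1 + ε d) * ((d : ℝ) / Real.log d))) := by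
  obtain ⟨p, ε, hε, hp⟩ := exists_selection_probability
  -- the loss in concentration is `δ = 1 / (d + 2)`, so that `(1 - δ)⁻¹ = 1 + 1 / (d + 1)`
  refine ⟨fun d => (1 + 1 / ((d : ℝ) + 1)) * (1 + ε d) - 1, ?_, fun d g hd _ => ?_⟩
  · have h1 : Filter.Tendsto (fun d : ℕ => 1 + 1 / ((d : ℝ) + 1)) Filter.atTop (nhds 1) := by
      simpa using tendsto_one_div_add_atTop_nhds_zero_nat.const_add (1 : ℝ)
    have h2 : Filter.Tendsto (fun d : ℕ => 1 + ε d) Filter.atTop (nhds 1) := by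
      simpa using hε.const_add (1 : ℝ)
    simpa using (h1.mul h2).sub_const 1
  -- Failure of `n` colours gives chromatic number at least `n + 1 = d`, while the out-degree is
  -- only at most `n`; a `p` admissible for exponent `d` is then admissible for `n`.
  · obtain ⟨n, rfl⟩ : ∃ n, d = n + 1 := ⟨d - 1, by omega⟩
    obtain ⟨V, hV, G, hcol, hforest, ⟨T⟩⟩ := exists_treeOrientation_not_colorable g n
    refine ⟨V, hV, G, ?_, ?_, fun hd2 => ?_⟩
    · rw [← SimpleGraph.chromaticNumber_le_iff_colorable, not_le] at hcol
      push_cast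
      exact Order.add_one_le_of_lt hcol
    · exact le_trans (by exact_mod_cast Nat.le_succ g) hforest.le_egirth
    · obtain ⟨hp0, hp1, hpd, hpε⟩ := hp (n + 1) hd2
      have hx : (0 : ℝ) < ((n + 1 : ℕ) : ℝ) := by positivity
      beta_reduce
      generalize ((n + 1 : ℕ) : ℝ) = x at hx hpε ⊢
      have hδ : (0 : ℝ) < 1 / (x + 2) := by positivity
      have hδ1 : 1 / (x + 2) < 1 := by
        rw [div_lt_one (by positivity)]
        linarith
      refine (T.fracDPChromaticNumber_le hp0 hp1 (hpd.trans ?_) hδ hδ1).trans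
        (ENNReal.ofReal_le_ofReal ?_)
      · exact pow_le_pow_of_le_one (by linarith) (by linarith) (Nat.le_succ n)
      · have hinv : (1 - 1 / (x + 2))⁻¹ = 1 + 1 / (x + 1) := by
          have : 1 - 1 / (x + 2) = (x + 1) / (x + 2) := by
            field_simp
            ring
          rw [this, inv_div]
          field_simp
          ring
        rw [mul_inv, hinv, add_sub_cancel, mul_assoc]
        exact mul_le_mul_of_nonneg_left hpε (by positivity)
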